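/- **Lemma (Disk of tangencies).** Let $r\ge 1$ and $0<\varepsilon<1$ be real, $\mathbb D\subset\mathbb C$ the open unit disk and $B_\rho\subset\mathbb C$ the disk of radius $\rho$ about $0$, $0<\rho\le 1$. ($C^s$ with real $s$ means: $\lfloor s\rfloor$ times continuously differentiable over $\mathbb R$, with top derivative locally Hölder of exponent $s-\lfloor s\rfloor$. A field of complex lines is $C^s$ if it is locally spanned by nowhere vanishing $C^s$ vector fields.) *Family.* Let $\{H_\mu\}_{\mu\in\mathbb D}$ be automorphisms of $\mathbb C^2$ such that $(\mu,x)\mapsto(\mu,H_\mu(x))$ is a $C^r$ diffeomorphism of $\mathbb D\times\mathbb C^2$. Let $U$ be open with $\Lambda_0$ a horseshoe of $H_0$ (a totally disconnected infinite basic set of saddle type), where $\Lambda_\mu=\bigcap_{n\in\mathbb Z}H_\mu^n(U)$; let $p_\mu\in\Lambda_\mu$ $(\mu\in B_\rho)$ be saddle fixed points of $H_\mu$ depending $C^r$ on $\mu$, and let $q\neq p_0$ be a homoclinic tangency: $q\in W^s(p_0)\cap W^u(p_0)$ and $T_qW^s(p_0)=T_qW^u(p_0)$. *Foliations.* Let $L$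 be compact, and for $\mu\in B_\rho$ let $\mathcal F^u_\mu$ be a $C^{1+\varepsilon}$ foliation of an open set by connected complex curves (embedded one-dimensional complex submanifolds), with leaf $\mathcal L^u_\mu(x)$ through $x$, such that: the domains form an open subset of $B_\rho\times\mathbb C^2$; $\Lambda_\mu\subset\operatorname{int}L$ and $L$ is contained in the domain of $\mathcal F^u_\mu$; for $x\in\Lambda_\mu$ the leaf $\mathcal L_\mu^u(x)$ lies in $W^u_\mu(x)$ and agrees near $x$ with a local unstable manifold $W^u_{\mu,\mathrm{loc}}(x)$; $H_\mu(\mathcal L^u_\mu(x))\supseteq\mathcal L^u_\mu(H_\mu(x))$ if $x\in L\cap H_\mu^{-1}(L)$; locally there are foliation charts, $C^{\min\{r,1+\varepsilon\}}$ jointly in the parameter and the point and $C^{1+\varepsilon}$ diffeomorphisms for each $\mu$; the line $T_x\mathcal L^u_\mu(x)$ is $C^{\min\{r,1+\varepsilon\}}$ jointly in $(\mu,x)$, and $C^{1+\varepsilon}$ in $x$ for each $\mu$. Let $\mathcal F^s_\mu$ have the same properties, with the same $U$ and $L$, for the family $\{H_\mu^{-1}\}$. Let $V$ be an open neighbourhood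 of $q$ contained in the domains of all these foliations, and assume that on $V$ they are obtained by iteration from the foliations around $L$: for $\mathcal F^u$ there is $n$ with $H_0^{-m}(q)\in\operatorname{int}L$ for all $m\ge n$ and, for $\mu\in B_\rho$ and $x\in V$, $H_\mu^{-n}(x)\in L$ and $\mathcal L^u_\mu(x)\subseteq H_\mu^n(\mathcal L^u_\mu(H_\mu^{-n}(x)))$; likewise for $\mathcal F^s$ with $H_\mu^{-1}$ in place of $H_\mu$. *Graph charts.* For $*\in\{u,s\}$ let $$\mathbb h^*_\mu(z,w)=(q_1+z,\;h^*_{\mu,w}(z))\in V,\qquad \mu\in B_\rho,\ z,w\in\mathbb D,\quad q=(q_1,q_2),$$ be $C^{\min\{r,1+\varepsilon\}}$ in $(\mu,z,w)$, for each $\mu$ a $C^{1+\varepsilon}$ diffeomorphism of $\mathbb D\times\mathbb D$ onto an open subset of $V$ that contains a bidisk $B_\delta(q_1)\times B_\delta(q_2)$ with $\delta>0$ independent of $\mu$, holomorphic in $z$, mapping each $\mathbb D\times\{w\}$ into a leaf of $\mathcal F^*_\mu$, with $\mathbb h^*_0(0,0)=q$ and $\mathbb h^*_\mu(\mathbb D\times\{0\})\subset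 W^*_\mu(p_\mu)$. Suppose $$\frac{\partial h^u_{0,0}}{\partial z}(0)=\frac{\partial h^s_{0,0}}{\partial z}(0),\qquad \frac{\partial^2 h^u_{0,0}}{\partial z^2}(0)\ne\frac{\partial^2 h^s_{0,0}}{\partial z^2}(0)$$ (the tangency at $q$ is quadratic). *Conclusion.* There are $0<\rho'\le\rho$ and maps $b_\mu:\mathbb D\to V$, $|\mu|<\rho'$, with $b_0(0)=q$, such that 1. each $b_\mu$ is a $C^{1+\varepsilon}$ embedding, with image a disk $D_\mu\subset V$; 2. for every $|\mu|<\rho'$ and every $x\in D_\mu$ the leaves $\mathcal L^u_\mu(x)$ and $\mathcal L^s_\mu(x)$ are tangent to each other at $x$; 3. $(\mu,\zeta)\mapsto b_\mu(\zeta)$ is of class $C^{\min\{r,1+\varepsilon\}}$ on $\{|\mu|<\rho'\}\times\mathbb D$; in particular the embeddings depend $C^r$ on $\mu$ if $r\le 1+\varepsilon$. For arbitrary $r\geq 1$, if the lines $T_x\mathcal L^u_\mu(x)$ and $T_x\mathcal L^s_\mu(x)$ are of class $C^r$ jointly in $(\mu,x)$ near $(0,q)$, then $(\mu,\zeta)\mapsto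 b_\mu(\zeta)$ is of class $C^r$. -/

import Mathlib

open Set Filter Topology

/-- The space `ℂ²` (its product norm has bidisks as balls). -/
abbrev C2 : Type := ℂ × ℂ

/-- The open unit disk of `ℂ`. -/
abbrev unitDisk : Set ℂ := Metric.ball 0 1

/-! ### Regularity classes and embeddings -/

/-- `f` is of class `C^s` on `U` (always used with `U` open), for a real exponent `s ≥ 0`, over the
reals: `f` is `⌊s⌋` times continuously differentiable and its derivative of order `⌊s⌋` is locally
Hölder with exponent `s - ⌊s⌋`. For an integer `s` the second clause is mere local boundedness,
which is automatic. -/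
def ClassOn {E F : Type*} [NormedAddCommGroup E] [NormedSpace ℝ E]
    [NormedAddCommGroup F] [NormedSpace ℝ F] (s : ℝ) (f : E → F) (U : Set E) : Prop :=
  ContDiffOn ℝ (⌊s⌋₊ : ℕ) f U ∧
    ∀ x ∈ U, ∃ C : ℝ, ∃ N ∈ 𝓝 x, ∀ y ∈ N ∩ U, ∀ z ∈ N ∩ U,
      ‖iteratedFDerivWithin ℝ ⌊s⌋₊ f U y - iteratedFDerivWithin ℝ ⌊s⌋₊ f U z‖
        ≤ C * ‖y - z‖ ^ (s - (⌊s⌋₊ : ℝ))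

/-- `f` restricts to a `C^s` diffeomorphism from the open set `A` onto an open set. -/
def DiffeoOn {E F : Type*} [NormedAddCommGroup E] [NormedSpace ℝ E]
    [NormedAddCommGroup F] [NormedSpace ℝ F] (s : ℝ) (f : E → F) (A : Set E) : Prop :=
  ClassOn s f A ∧ IsOpen (f '' A) ∧ ∃ g : F → E, LeftInvOn g f A ∧ ClassOn s g (f '' A)

/-- `b` is a `C^s` embedding of the open unit disk into `ℂ²` (as a real surface). -/
def EmbedsDisk (s : ℝ) (b : ℂ → C2) : Prop :=
  ClassOn s b unitDisk ∧ (∀ ζ ∈ unitDisk, Function.Injective (fderiv ℝ b ζ)) ∧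
    IsEmbedding (unitDisk.domRestrict b)

/-! ### Automorphisms of `ℂ²` and their hyperbolic sets -/

/-- A bijection of `ℂ²` is an automorphism if it and its inverse are holomorphic. -/
def IsAut (G : Equiv.Perm C2) : Prop :=
  Differentiable ℂ (G : C2 → C2) ∧ Differentiable ℂ (G.symm : C2 → C2)

/-- A family of automorphisms parametrized by the unit disk such that `(μ, x) ↦ (μ, H_μ x)` is a
`C^r` diffeomorphism of `𝔻 × ℂ²`. -/
def IsAutFamily (r : ℝ) (H : ℂ → Equiv.Perm C2) : Prop :=
  (∀ μ ∈ unitDisk, IsAut (H μ)) ∧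
    ClassOn r (fun a : ℂ × C2 => H a.1 a.2) (unitDisk ×ˢ univ) ∧
    ClassOn r (fun a : ℂ × C2 => (H a.1).symm a.2) (unitDisk ×ˢ univ)

/-- The maximal invariant set `⋂ₙ Gⁿ(U)`, `n ∈ ℤ`. -/
def maxInvariant (G : Equiv.Perm C2) (U : Set C2) : Set C2 :=
  ⋂ n : ℤ, (G ^ n : Equiv.Perm C2) '' U

/-- `K` is a hyperbolic set of saddle type of `G`: it is compact and invariant and carries an
invariant splitting into two nontrivial subbundles, the first contracted by forward iteration and
the second by backward iteration. -/
def IsSaddleHyperbolic (G : Equiv.Perm C2) (K : Set C2) : Prop :=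
  IsCompact K ∧ G '' K = K ∧
    ∃ (Es Eu : C2 → Submodule ℂ C2) (C lam : ℝ), 0 < C ∧ 0 < lam ∧ lam < 1 ∧
      ∀ x ∈ K, IsCompl (Es x) (Eu x) ∧ Es x ≠ ⊥ ∧ Eu x ≠ ⊥ ∧
        (Es x).map (fderiv ℂ G x : C2 →ₗ[ℂ] C2) = Es (G x) ∧
        (Eu x).map (fderiv ℂ G x : C2 →ₗ[ℂ] C2) = Eu (G x) ∧
        (∀ (n : ℕ), ∀ v ∈ Es x, ‖fderiv ℂ (G ^ n : Equiv.Perm C2) x v‖ ≤ C * lam ^ n * ‖v‖) ∧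
        (∀ (n : ℕ), ∀ v ∈ Eu x, ‖fderiv ℂ (G⁻¹ ^ n : Equiv.Perm C2) x v‖ ≤ C * lam ^ n * ‖v‖)

/-- A complex horseshoe: a totally disconnected infinite basic set (hyperbolic, with a dense orbit,
locally maximal) of saddle type. -/
def IsHorseshoe (G : Equiv.Perm C2) (K : Set C2) : Prop :=
  IsSaddleHyperbolic G K ∧ K.Infinite ∧ IsTotallyDisconnected K ∧
    (∃ x ∈ K, K ⊆ closure (range fun n : ℤ => (G ^ n : Equiv.Perm C2) x)) ∧
    ∃ U : Set C2, IsOpen U ∧ K ⊆ U ∧ K = maxInvariant G U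

/-- A fixed point of saddle type: one multiplier inside and one outside the unit circle. -/
def IsFixedSaddle (G : Equiv.Perm C2) (p : C2) : Prop :=
  G p = p ∧ ∃ l₁ l₂ : ℂ, ‖l₁‖ < 1 ∧ 1 < ‖l₂‖ ∧
    Module.End.HasEigenvalue (fderiv ℂ G p : C2 →ₗ[ℂ] C2) l₁ ∧
    Module.End.HasEigenvalue (fderiv ℂ G p : C2 →ₗ[ℂ] C2) l₂

/-- The stable manifold of `x`. -/
def stableSet (G : Equiv.Perm C2) (x : C2) : Set C2 :=
  {y | Tendsto (fun n : ℕ => dist ((G ^ n : Equiv.Perm C2) y) ((G ^ n : Equiv.Perm C2) x))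
    atTop (𝓝 0)}

/-- The unstable manifold of `x`. -/
def unstableSet (G : Equiv.Perm C2) (x : C2) : Set C2 := stableSet G⁻¹ x

/-- The local unstable manifold of size `δ` of `x`. -/
def localUnstableSet (G : Equiv.Perm C2) (δ : ℝ) (x : C2) : Set C2 :=
  {y ∈ unstableSet G x |
    ∀ n : ℕ, dist ((G⁻¹ ^ n : Equiv.Perm C2) y) ((G⁻¹ ^ n : Equiv.Perm C2) x) < δ}

/-- `γ` parametrizes `W` as an injectively immersed holomorphic copy of `ℂ`. -/
def ParametrizesImmersed (γ : ℂ → C2) (W : Set C2) : Prop :=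
  Differentiable ℂ γ ∧ Function.Injective γ ∧ (∀ t, deriv γ t ≠ 0) ∧ range γ = W

/-- `q` is a homoclinic tangency of the fixed point `p`: it lies on the stable and the unstable
manifolds of `p`, differs from `p`, and the two (immersed) manifolds have the same tangent line
at `q`. -/
def IsHomoclinicTangency (G : Equiv.Perm C2) (p q : C2) : Prop :=
  q ≠ p ∧ ∃ γu γs : ℂ → C2,
    ParametrizesImmersed γu (unstableSet G p) ∧ ParametrizesImmersed γs (stableSet G p) ∧
    ∃ a b : ℂ, γu a = q ∧ γs b = q ∧
      Submodule.span ℂ {deriv γu a} = Submodule.span ℂ {deriv γs b}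

/-! ### Families of foliations by holomorphic curves -/

/-- `S` is an embedded complex submanifold of `ℂ²` of dimension one. -/
def IsComplexCurve (S : Set C2) : Prop :=
  ∀ x ∈ S, ∃ (N : Set C2) (g : C2 → ℂ), IsOpen N ∧ x ∈ N ∧ DifferentiableOn ℂ g N ∧
    fderiv ℂ g x ≠ 0 ∧ S ∩ N = {y ∈ N | g y = 0}

/-- The tangent space at `x` of the leaf through `x`, for the parameter `μ`, where `a = (μ, x)`. -/
def leafTangent (leaf : ℂ → C2 → Set C2) (a : ℂ × C2) : Set C2 :=
  tangentConeAt ℂ (leaf a.1 a.2) a.2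

/-- `A` and `B` are tangent to each other at their common point `x`. -/
def TangentAt (A B : Set C2) (x : C2) : Prop :=
  x ∈ A ∧ x ∈ B ∧ tangentConeAt ℂ A x = tangentConeAt ℂ B x

/-- A field `l` of complex lines of `ℂ²` is of class `C^s` on `O`: near every point it is spanned
by a nowhere vanishing vector field of class `C^s`. -/
def LineFieldOn {E : Type*} [NormedAddCommGroup E] [NormedSpace ℝ E]
    (s : ℝ) (l : E → Set C2) (O : Set E) : Prop :=
  ∀ a ∈ O, ∃ (N : Set E) (X : E → C2), IsOpen N ∧ a ∈ N ∧ N ⊆ O ∧ ClassOn s X N ∧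
    ∀ b ∈ N, X b ≠ 0 ∧ l b = (Submodule.span ℂ {X b} : Set C2)

/-- `φ(μ, z, w)`, for `μ ∈ M` and `z, w ∈ 𝔻`, is a family of foliation charts with values in `V`:
`C^{min(r, 1+ε)}` in all variables, a `C^{1+ε}` diffeomorphism of `𝔻 × 𝔻` onto an open subset of
`V` for each `μ`, holomorphic in `z`, and sending each disk `𝔻 × {w}` into a leaf. -/
structure IsFoliationChart (r ε : ℝ) (leaf : ℂ → C2 → Set C2) (M : Set ℂ) (V : ℂ → Set C2)
    (φ : ℂ → ℂ → ℂ → C2) : Prop where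
  joint : ClassOn (min r (1 + ε)) (fun a : ℂ × ℂ × ℂ => φ a.1 a.2.1 a.2.2)
    (M ×ˢ (unitDisk ×ˢ unitDisk))
  diffeo : ∀ μ ∈ M, DiffeoOn (1 + ε) (fun b : ℂ × ℂ => φ μ b.1 b.2) (unitDisk ×ˢ unitDisk)
  mapsTo : ∀ μ ∈ M, ∀ z ∈ unitDisk, ∀ w ∈ unitDisk, φ μ z w ∈ V μ
  holomorphic : ∀ μ ∈ M, ∀ w ∈ unitDisk, DifferentiableOn ℂ (fun z => φ μ z w) unitDisk
  plaque : ∀ μ ∈ M, ∀ w ∈ unitDisk, ∀ z ∈ unitDisk, ∀ z' ∈ unitDisk,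
    φ μ z' w ∈ leaf μ (φ μ z w)

/-- `leaf μ x` (for `(μ, x) ∈ O`, where `O` is open in `B_ρ(0) × ℂ²`) are the leaves of a family of
`C^{1+ε}` unstable foliations of the sets `O_μ`, adapted to the maximal invariant sets
`Λ_μ = ⋂ₙ H_μⁿ(U)` and their common compact neighbourhood `L`. The stable foliations of a family are
the unstable foliations of the family of inverses. -/
structure IsUnstableFoliation (r ε ρ : ℝ) (H : ℂ → Equiv.Perm C2) (U L : Set C2)
    (O : Set (ℂ × C2)) (leaf : ℂ → C2 → Set C2) : Prop where
  isOpen : IsOpen O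
  param : ∀ a ∈ O, a.1 ∈ Metric.ball (0 : ℂ) ρ
  -- the leaves partition `O_μ`
  mem_leaf : ∀ μ x, (μ, x) ∈ O → x ∈ leaf μ x
  leaf_subset : ∀ μ x, (μ, x) ∈ O → ∀ y ∈ leaf μ x, (μ, y) ∈ O
  leaf_eq : ∀ μ x, (μ, x) ∈ O → ∀ y ∈ leaf μ x, leaf μ y = leaf μ x
  -- they are connected complex manifolds
  isComplexCurve : ∀ μ x, (μ, x) ∈ O → IsComplexCurve (leaf μ x)
  isConnected : ∀ μ x, (μ, x) ∈ O → IsConnected (leaf μ x)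
  -- local triviality, with charts depending on the parameter
  chart : ∀ μ₀ x₀, (μ₀, x₀) ∈ O → ∃ (η : ℝ) (φ : ℂ → ℂ → ℂ → C2), 0 < η ∧
    Metric.ball μ₀ η ⊆ Metric.ball 0 ρ ∧ φ μ₀ 0 0 = x₀ ∧
    IsFoliationChart r ε leaf (Metric.ball μ₀ η) (fun μ => {x | (μ, x) ∈ O}) φ
  -- `Λ_μ ⊂ int L` and `L ⊂ O_μ`
  invariant_subset : ∀ μ ∈ Metric.ball (0 : ℂ) ρ, maxInvariant (H μ) U ⊆ interior L
  subset_domain : ∀ μ ∈ Metric.ball (0 : ℂ) ρ, ∀ x ∈ L, (μ, x) ∈ O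
  -- at points of `Λ_μ` the leaf agrees with the local unstable manifold
  agrees : ∀ μ ∈ Metric.ball (0 : ℂ) ρ, ∀ x ∈ maxInvariant (H μ) U,
    leaf μ x ⊆ unstableSet (H μ) x ∧
    ∃ δ > 0, ∃ N ∈ 𝓝 x, leaf μ x ∩ N = localUnstableSet (H μ) δ x ∩ N
  -- the foliation is semi-invariant
  semiinvariant : ∀ μ ∈ Metric.ball (0 : ℂ) ρ, ∀ x ∈ L, H μ x ∈ L →
    leaf μ (H μ x) ⊆ H μ '' leaf μ x
  -- regularity of the tangent spaces of the leaves
  tangent_joint : LineFieldOn (min r (1 + ε)) (leafTangent leaf) O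
  tangent_fiber : ∀ μ ∈ Metric.ball (0 : ℂ) ρ,
    LineFieldOn (1 + ε) (fun x => leafTangent leaf (μ, x)) {x | (μ, x) ∈ O}

/-- On the open set `V` around `q` the foliations are the ones obtained by iteration from those
around `L`, the backward orbit of `q` being in `int L` from the time `n` on. -/
def ExtendedByIteration (ρ : ℝ) (H : ℂ → Equiv.Perm C2) (L : Set C2) (O : Set (ℂ × C2))
    (leaf : ℂ → C2 → Set C2) (V : Set C2) (q : C2) : Prop :=
  ∃ n : ℕ, (∀ m : ℕ, n ≤ m → ((H 0)⁻¹ ^ m : Equiv.Perm C2) q ∈ interior L) ∧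
    ∀ μ ∈ Metric.ball (0 : ℂ) ρ, ∀ x ∈ V, (μ, x) ∈ O ∧
      ((H μ)⁻¹ ^ n : Equiv.Perm C2) x ∈ L ∧
      leaf μ x ⊆ (H μ ^ n : Equiv.Perm C2) '' leaf μ (((H μ)⁻¹ ^ n : Equiv.Perm C2) x)

/-- `h` describes the foliations near `q` by graphs: the charts are
`(μ, z, w) ↦ (q₁ + z, h(μ, z, w))`, they send `(0, 0, 0)` to `q`, their images contain a fixed
bidisk around `q`, and the leaf `w = 0` is a piece of the manifold `W μ`. -/
structure IsGraphChart (r ε ρ δ : ℝ) (leaf : ℂ → C2 → Set C2) (V : Set C2) (q : C2)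
    (W : ℂ → Set C2) (h : ℂ → ℂ → ℂ → ℂ) : Prop where
  chart : IsFoliationChart r ε leaf (Metric.ball 0 ρ) (fun _ => V) (fun μ z w => (q.1 + z, h μ z w))
  base : h 0 0 0 = q.2
  covers : ∀ μ ∈ Metric.ball (0 : ℂ) ρ, Metric.ball q δ ⊆
    (fun b : ℂ × ℂ => ((q.1 + b.1, h μ b.1 b.2) : C2)) '' (unitDisk ×ˢ unitDisk)
  manifold : ∀ μ ∈ Metric.ball (0 : ℂ) ρ, ∀ z ∈ unitDisk, (q.1 + z, h μ z 0) ∈ W μ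

/-!
The tangency locus is cut out by one equation. In the coordinates of `ℂ²`, let `Su(μ, x)` and
`Ss(μ, x)` be the slopes of the leaves of the two foliations through `x`; near `(0, q)` the leaves
are not vertical, since they are graphs, and so the slopes inherit the regularity of the tangent
line fields (`LineFieldOn.holderAt_lineSlope`). The leaves through `x` are tangent at `x` exactly
when `D = Su - Ss` vanishes at `(μ, x)`.

The leaf through `q` is the graph of `g = g₀(·, 0)`, and along it the slope is `g'`. Therefore the
derivative at `q` of the slope, along the complex tangent line of the leaf, is multiplication by
`g''(0)` (`IsGraphChart.fderiv_lineSlope`). Both leaves have the same tangent line at `q`, of slope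
`m`, so the derivative of `D` along that line is multiplication by the difference of the two second
derivatives. It is nonzero because the tangency is quadratic, and multiplication by a nonzero
complex number is an invertible real-linear map. In the coordinates
`(t, y) ↦ q + (t, m t + y)` the implicit function theorem then describes the zero set of `D(μ, ·)`
as a graph `t = t(μ, y)` over a disk of radius `κ` (`exists_implicit_shear`), and
`b_μ(ζ) = q + (t, m t + κ ζ)` with `t = t(μ, κ ζ)`. It is an embedding because `ζ` is an affine
function of `b_μ(ζ)` (`embedsDisk_shear`).

For the regularity, the Hölder classes `C^{k,α}` are treated as a pointwise notion `HolderAt`,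
stable under composition. From `Dt = -(∂₂f)⁻¹ ∘ ∂₁f` a `C^1` implicit function has the class of its
equation (`HolderAt.implicit`). This applies to `D` in all variables, for either joint regularity
class, and to `D(μ, ·)` for each fixed `μ`, whose class `C^{1+ε}` may be better than the joint one.
-/

universe u

/-! ### Hölder classes at a point -/

section HolderClasses

variable {E F G : Type u} [NormedAddCommGroup E] [NormedSpace ℝ E]
  [NormedAddCommGroup F] [NormedSpace ℝ F] [NormedAddCommGroup G] [NormedSpace ℝ G]
  {k : ℕ} {α : ℝ}

/-- `f` is of class `C^{k,α}` near `x`: it is `C^k` at `x` and its derivative of order `k` is Hölder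
of exponent `α` on a neighbourhood of `x`. Pairs of points near `x` are encoded by the filter
`𝓝 (x, x)`. For `α = 0` the second clause is implied by the first. -/
def HolderAt (k : ℕ) (α : ℝ) (f : E → F) (x : E) : Prop :=
  ContDiffAt ℝ k f x ∧ ∃ C : ℝ, ∀ᶠ p in 𝓝 (x, x),
    ‖iteratedFDeriv ℝ k f p.1 - iteratedFDeriv ℝ k f p.2‖ ≤ C * ‖p.1 - p.2‖ ^ α

/-- On an open set the class `C^s` is a local notion. -/
theorem classOn_iff_holderAt {s : ℝ} {f : E → F} {U : Set E} (hU : IsOpen U) :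
    ClassOn s f U ↔ ∀ x ∈ U, HolderAt ⌊s⌋₊ (s - ⌊s⌋₊) f x := by
  have key := iteratedFDerivWithin_of_isOpen (𝕜 := ℝ) (f := f) ⌊s⌋₊ hU
  constructor
  · rintro ⟨h1, h2⟩ x hx
    refine ⟨h1.contDiffAt (hU.mem_nhds hx), ?_⟩
    obtain ⟨C, N, hN, h⟩ := h2 x hx
    refine ⟨C, ?_⟩
    have hNU := inter_mem hN (hU.mem_nhds hx)
    filter_upwards [prod_mem_nhds hNU hNU] with p hp
    rw [← key hp.1.2, ← key hp.2.2]
    exact h _ hp.1 _ hp.2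
  · intro h
    refine ⟨fun x hx => (h x hx).1.contDiffWithinAt, fun x hx => ?_⟩
    obtain ⟨C, hC⟩ := (h x hx).2
    rw [nhds_prod_eq, Filter.Eventually, mem_prod_self_iff] at hC
    obtain ⟨N, hN, hN'⟩ := hC
    refine ⟨C, N, hN, fun y hy z hz => ?_⟩
    rw [key hy.2, key hz.2]
    have : (y, z) ∈ N ×ˢ N := mk_mem_prod hy.1 hz.1
    have h2 := hN' this
    rw [mem_ofPred_eq] at h2
    exact h2

theorem HolderAt.congr {f g : E → F} {x : E} (hf : HolderAt k α f x) (h : g =ᶠ[𝓝 x] f) :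
    HolderAt k α g x := by
  refine ⟨hf.1.congr_of_eventuallyEq h, ?_⟩
  obtain ⟨C, hC⟩ := hf.2
  have h' := h.iteratedFDeriv ℝ k
  refine ⟨C, ?_⟩
  filter_upwards [hC, prod_mem_nhds h' h'] with p hp hp'
  rw [hp'.1, hp'.2]
  exact hp

theorem HolderAt.eventually {f : E → F} {x : E} (hf : HolderAt k α f x) :
    ∀ᶠ y in 𝓝 x, HolderAt k α f y := by
  obtain ⟨h1, C, hC⟩ := hf
  have h2 := (continuous_id.prodMk continuous_id).tendsto x |>.eventually hC.eventually_nhds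
  filter_upwards [h1.eventually (by simp), h2] with y hy hy'
  exact ⟨hy, C, hy'⟩

theorem holderAt_zero_iff {f : E → F} {x : E} :
    HolderAt 0 α f x ↔ ContDiffAt ℝ 0 f x ∧ ∃ C : ℝ, ∀ᶠ p in 𝓝 (x, x),
      ‖f p.1 - f p.2‖ ≤ C * ‖p.1 - p.2‖ ^ α := by
  simp only [HolderAt, iteratedFDeriv_zero_eq_comp, Function.comp_apply, ← map_sub,
    LinearIsometryEquiv.norm_map, Nat.cast_zero]

theorem contDiffAt_succ_iff_fderiv {f : E → F} {x : E} :
    ContDiffAt ℝ (k + 1 : ℕ) f x ↔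
      (∀ᶠ y in 𝓝 x, DifferentiableAt ℝ f y) ∧ ContDiffAt ℝ k (fderiv ℝ f) x := by
  constructor
  · intro h
    refine ⟨?_, h.fderiv_right (by norm_cast)⟩
    filter_upwards [h.eventually (by simp)] with y hy using hy.differentiableAt (by simp)
  · rintro ⟨h1, h2⟩
    push_cast
    exact contDiffAt_succ_iff_hasFDerivAt.2
      ⟨fderiv ℝ f, ⟨_, h1, fun y hy => DifferentiableAt.hasFDerivAt hy⟩, h2⟩

/-- The recursive description of `C^{k,α}`, on which the inductions on `k` rest. -/
theorem holderAt_succ_iff {f : E → F} {x : E} :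
    HolderAt (k + 1) α f x ↔
      (∀ᶠ y in 𝓝 x, DifferentiableAt ℝ f y) ∧ HolderAt k α (fderiv ℝ f) x := by
  have key : ∀ y z, ‖iteratedFDeriv ℝ (k + 1) f y - iteratedFDeriv ℝ (k + 1) f z‖ =
      ‖iteratedFDeriv ℝ k (fderiv ℝ f) y - iteratedFDeriv ℝ k (fderiv ℝ f) z‖ := fun y z => by
    rw [iteratedFDeriv_succ_eq_comp_right, iteratedFDeriv_succ_eq_comp_right]
    simp only [Function.comp_apply, ← dist_eq_norm]
    exact (continuousMultilinearCurryRightEquiv' ℝ k E F).symm.dist_map _ _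
  simp only [HolderAt, contDiffAt_succ_iff_fderiv, key, and_assoc]

/-- A `C^{k+1}` map has a locally Lipschitz derivative of order `k`, hence is `C^{k,α}`, `α ≤ 1`. -/
theorem holderAt_of_contDiffAt (hα : α ≤ 1) {f : E → F} {x : E}
    (hf : ContDiffAt ℝ (k + 1 : ℕ) f x) : HolderAt k α f x := by
  refine ⟨hf.of_le (by norm_cast; omega), ?_⟩
  have h1 : ContDiffAt ℝ 1 (iteratedFDeriv ℝ k f) x :=
    hf.iteratedFDeriv_right (by norm_cast; omega)
  obtain ⟨K, t, ht, hK⟩ := h1.exists_lipschitzOnWith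
  have hB := Metric.ball_mem_nhds x (half_pos (zero_lt_one (α := ℝ)))
  have hN := inter_mem ht hB
  refine ⟨K, ?_⟩
  filter_upwards [prod_mem_nhds hN hN] with p hp
  refine (hK.norm_sub_le hp.1.1 hp.2.1).trans (mul_le_mul_of_nonneg_left ?_ K.2)
  have hlt : ‖p.1 - p.2‖ ≤ 1 := by
    rw [← dist_eq_norm]
    have h1 := Metric.mem_ball.1 hp.1.2
    have h2 := Metric.mem_ball'.1 hp.2.2
    have := dist_triangle p.1 x p.2
    linarith
  rcases (norm_nonneg (p.1 - p.2)).eq_or_lt with h0 | h0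
  · rw [← h0]; positivity
  · calc ‖p.1 - p.2‖ = ‖p.1 - p.2‖ ^ (1 : ℝ) := (Real.rpow_one _).symm
      _ ≤ _ := Real.rpow_le_rpow_of_exponent_ge h0 hlt hα

theorem HolderAt.of_succ (hα : α ≤ 1) {f : E → F} {x : E} (hf : HolderAt (k + 1) α f x) :
    HolderAt k α f x :=
  holderAt_of_contDiffAt hα hf.1

theorem HolderAt.clm_comp {f : E → F} {x : E} (hf : HolderAt k α f x) (A : F →L[ℝ] G) :
    HolderAt k α (fun y => A (f y)) x := by
  obtain ⟨h1, C, hC⟩ := hf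
  refine ⟨A.contDiff.contDiffAt.comp x h1, ‖A‖ * C, ?_⟩
  have h2 := h1.eventually (by simp)
  filter_upwards [hC, prod_mem_nhds h2 h2] with p hp hp'
  have e : ∀ y, ContDiffAt ℝ k f y → iteratedFDeriv ℝ k (fun y => A (f y)) y =
      A.compContinuousMultilinearMap (iteratedFDeriv ℝ k f y) := fun y hy =>
    A.iteratedFDeriv_comp_left hy le_rfl
  rw [e _ hp'.1, e _ hp'.2]
  have : A.compContinuousMultilinearMap (iteratedFDeriv ℝ k f p.1) -
      A.compContinuousMultilinearMap (iteratedFDeriv ℝ k f p.2) =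
      A.compContinuousMultilinearMap (iteratedFDeriv ℝ k f p.1 - iteratedFDeriv ℝ k f p.2) := by
    ext; simp
  rw [this, mul_assoc]
  exact (A.norm_compContinuousMultilinearMap_le _).trans
    (mul_le_mul_of_nonneg_left hp (norm_nonneg _))

theorem HolderAt.add {f g : E → F} {x : E} (hf : HolderAt k α f x) (hg : HolderAt k α g x) :
    HolderAt k α (fun y => f y + g y) x := by
  obtain ⟨h1, C, hC⟩ := hf
  obtain ⟨h1', C', hC'⟩ := hg
  refine ⟨h1.add h1', C + C', ?_⟩
  have h2 := (h1.eventually (by simp)).and (h1'.eventually (by simp))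
  filter_upwards [hC, hC', prod_mem_nhds h2 h2] with p hp hp' hh
  have e : ∀ y, ContDiffAt ℝ k f y → ContDiffAt ℝ k g y →
      iteratedFDeriv ℝ k (fun y => f y + g y) y =
      iteratedFDeriv ℝ k f y + iteratedFDeriv ℝ k g y := fun y hy hy' =>
    iteratedFDeriv_add_apply hy hy'
  rw [e _ hh.1.1 hh.1.2, e _ hh.2.1 hh.2.2, add_mul, add_sub_add_comm]
  exact (norm_add_le _ _).trans (add_le_add hp hp')

theorem HolderAt.sub {f g : E → F} {x : E} (hf : HolderAt k α f x) (hg : HolderAt k α g x) :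
    HolderAt k α (fun y => f y - g y) x := by
  simpa [sub_eq_add_neg] using hf.add (hg.clm_comp (-ContinuousLinearMap.id ℝ F))

theorem HolderAt.prodMk {f : E → F} {g : E → G} {x : E} (hf : HolderAt k α f x)
    (hg : HolderAt k α g x) : HolderAt k α (fun y => (f y, g y)) x := by
  have := (hf.clm_comp (ContinuousLinearMap.inl ℝ F G)).add
    (hg.clm_comp (ContinuousLinearMap.inr ℝ F G))
  simpa using this

end HolderClasses

/-! ### Composition and implicit functions in Hölder classes -/

section HolderComposition

open scoped ContDiff

variable {E : Type u} [NormedAddCommGroup E] [NormedSpace ℝ E] {α : ℝ}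

/-- Post-composition with a smooth map preserves `C^{k,α}`. -/
theorem HolderAt.smooth_comp (hα : α ≤ 1) {k : ℕ} :
    ∀ {F G : Type u} [NormedAddCommGroup F] [NormedSpace ℝ F] [NormedAddCommGroup G]
      [NormedSpace ℝ G] {f : F → G} {g : E → F} {x : E},
      ContDiffAt ℝ ∞ f (g x) → HolderAt k α g x → HolderAt k α (fun y => f (g y)) x := by
  induction k with
  | zero =>
    intro F G _ _ _ _ f g x hf hg
    rw [holderAt_zero_iff] at hg ⊢
    obtain ⟨h1, C, hC⟩ := hg
    refine ⟨(hf.of_le (by simp)).comp x h1, ?_⟩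
    obtain ⟨K, t, ht, hK⟩ := (hf.of_le (by simp) : ContDiffAt ℝ 1 f (g x)).exists_lipschitzOnWith
    have ht' := h1.continuousAt.preimage_mem_nhds ht
    refine ⟨K * C, ?_⟩
    filter_upwards [hC, prod_mem_nhds ht' ht'] with p hp hp'
    rw [mul_assoc]
    exact (hK.norm_sub_le hp'.1 hp'.2).trans (mul_le_mul_of_nonneg_left hp K.2)
  | succ k ih =>
    intro F G _ _ _ _ f g x hf hg
    have hg' := holderAt_succ_iff.1 hg
    have hfd : ∀ᶠ y in 𝓝 x, DifferentiableAt ℝ f (g y) := by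
      have h1 : ContDiffAt ℝ 1 f (g x) := hf.of_le (by simp)
      filter_upwards [hg.1.continuousAt.eventually (h1.eventually (by simp))] with y hy
      exact hy.differentiableAt (by simp)
    refine holderAt_succ_iff.2 ⟨?_, ?_⟩
    · filter_upwards [hg'.1, hfd] with y hy hy' using hy'.comp y hy
    · have hDf : ContDiffAt ℝ ∞ (fderiv ℝ f) (g x) := hf.fderiv_right (by simp)
      have h1 := ih hDf (hg.of_succ hα)
      have h2 := ih (f := fun P : (F →L[ℝ] G) × (E →L[ℝ] F) => P.1.comp P.2)
        (g := fun y => (fderiv ℝ f (g y), fderiv ℝ g y)) (x := x)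
        (contDiff_fst.clm_comp contDiff_snd).contDiffAt (h1.prodMk hg'.2)
      refine h2.congr ?_
      filter_upwards [hg'.1, hfd] with y hy hy' using fderiv_comp y hy' hy

/-- `C^{k,α}` is closed under composition with an inner map that is also `C^1`. The `C^1` hypothesis
matters only for `k = 0`, where Hölder exponents would otherwise multiply. -/
theorem HolderAt.comp (hα0 : 0 ≤ α) (hα : α ≤ 1) {k : ℕ} :
    ∀ {F G : Type u} [NormedAddCommGroup F] [NormedSpace ℝ F] [NormedAddCommGroup G]
      [NormedSpace ℝ G] {f : F → G} {g : E → F} {x : E},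
      HolderAt k α f (g x) → HolderAt k α g x → ContDiffAt ℝ 1 g x →
      HolderAt k α (fun y => f (g y)) x := by
  induction k with
  | zero =>
    intro F G _ _ _ _ f g x hf hg hg1
    rw [holderAt_zero_iff] at hf ⊢
    obtain ⟨h1, C, hC⟩ := hf
    refine ⟨h1.comp x hg.1, ?_⟩
    obtain ⟨K, t, ht, hK⟩ := hg1.exists_lipschitzOnWith
    refine ⟨|C| * (K : ℝ) ^ α, ?_⟩
    have hcont : Tendsto (fun p : E × E => (g p.1, g p.2)) (𝓝 (x, x)) (𝓝 (g x, g x)) := by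
      rw [nhds_prod_eq, nhds_prod_eq]
      exact hg1.continuousAt.tendsto.prodMap hg1.continuousAt.tendsto
    filter_upwards [hcont.eventually hC, prod_mem_nhds ht ht] with p hp hp'
    calc ‖f (g p.1) - f (g p.2)‖ ≤ C * ‖g p.1 - g p.2‖ ^ α := hp
      _ ≤ |C| * ‖g p.1 - g p.2‖ ^ α := by gcongr; exact le_abs_self C
      _ ≤ |C| * (K * ‖p.1 - p.2‖) ^ α := by gcongr; exact hK.norm_sub_le hp'.1 hp'.2
      _ = _ := by rw [Real.mul_rpow K.coe_nonneg (norm_nonneg _), mul_assoc]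
  | succ k ih =>
    intro F G _ _ _ _ f g x hf hg hg1
    have hg' := holderAt_succ_iff.1 hg
    have hf' := holderAt_succ_iff.1 hf
    have hfd := hg1.continuousAt.eventually hf'.1
    refine holderAt_succ_iff.2 ⟨?_, ?_⟩
    · filter_upwards [hg'.1, hfd] with y hy hy' using hy'.comp y hy
    · have h1 := ih hf'.2 (hg.of_succ hα) hg1
      have h2 := HolderAt.smooth_comp hα
        (f := fun P : (F →L[ℝ] G) × (E →L[ℝ] F) => P.1.comp P.2)
        (g := fun y => (fderiv ℝ f (g y), fderiv ℝ g y)) (x := x)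
        (contDiff_fst.clm_comp contDiff_snd).contDiffAt (h1.prodMk hg'.2)
      refine h2.congr ?_
      filter_upwards [hg'.1, hfd] with y hy hy' using fderiv_comp y hy' hy

/-- Regularity of implicit functions: a `C^1` solution `t` of `f (a, t a) = c` is as regular as `f`.
Indeed `Dt = -(∂₂f)⁻¹ ∘ ∂₁f` along the graph of `t`, which turns the regularity of `t` of one order
into regularity of the next order as long as `Df` has it. -/
theorem HolderAt.implicit (hα0 : 0 ≤ α) (hα : α ≤ 1) {F G : Type u} [NormedAddCommGroup F]
    [NormedSpace ℝ F] [CompleteSpace F] [NormedAddCommGroup G] [NormedSpace ℝ G]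
    {f : E × F → G} {t : E → F} {c : G} {a : E} {k : ℕ}
    (hf : HolderAt (k + 1) α f (a, t a)) (ht : ContDiffAt ℝ 1 t a)
    (hinv : (fderiv ℝ f (a, t a) ∘L .inr ℝ E F).IsInvertible)
    (hc : ∀ᶠ y in 𝓝 a, f (y, t y) = c) : HolderAt (k + 1) α t a := by
  set g : E → E × F := fun y => (y, t y)
  have hg1 : ContDiffAt ℝ 1 g a := contDiffAt_id.prodMk ht
  have htd : ∀ᶠ y in 𝓝 a, DifferentiableAt ℝ t y := by
    filter_upwards [ht.eventually (by simp)] with y hy using hy.differentiableAt (by simp)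
  have hfd : ∀ᶠ y in 𝓝 a, DifferentiableAt ℝ f (g y) :=
    hg1.continuousAt.eventually (holderAt_succ_iff.1 hf).1
  -- the formula for `Dt` as a smooth function of `Df`
  let Ψ : (E × F →L[ℝ] G) → (E →L[ℝ] F) := fun A =>
    -((A ∘L .inr ℝ E F).inverse ∘L (A ∘L .inl ℝ E F))
  have hΨ : ContDiffAt ℝ ∞ Ψ (fderiv ℝ f (g a)) := by
    have e1 : ContDiff ℝ ∞ fun A : E × F →L[ℝ] G => A ∘L .inr ℝ E F :=
      contDiff_id.clm_comp contDiff_const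
    have e2 : ContDiff ℝ ∞ fun A : E × F →L[ℝ] G => A ∘L .inl ℝ E F :=
      contDiff_id.clm_comp contDiff_const
    have e3 : ContDiffAt ℝ ∞ (fun A : E × F →L[ℝ] G => (A ∘L .inr ℝ E F).inverse)
        (fderiv ℝ f (g a)) :=
      ContDiffAt.comp _ (g := ContinuousLinearMap.inverse)
        hinv.contDiffAt_map_inverse e1.contDiffAt
    exact (e3.clm_comp e2.contDiffAt).neg
  have hinv' : ∀ᶠ y in 𝓝 a, (fderiv ℝ f (g y) ∘L .inr ℝ E F).IsInvertible := by
    have hcont : ContinuousAt (fun y => fderiv ℝ f (g y) ∘L .inr ℝ E F) a := by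
      have h1 : ContinuousAt (fderiv ℝ f) (g a) := (holderAt_succ_iff.1 hf).2.1.continuousAt
      exact (ContinuousAt.comp h1 hg1.continuousAt).clm_comp continuousAt_const
    obtain ⟨M, hM⟩ := hinv
    have hM' : {A : F →L[ℝ] G | A.IsInvertible} ∈
        𝓝 (fderiv ℝ f (g a) ∘L ContinuousLinearMap.inr ℝ E F) := by
      have := M.nhds
      rwa [hM] at this
    exact hcont hM'
  have hD : fderiv ℝ t =ᶠ[𝓝 a] fun y => Ψ (fderiv ℝ f (g y)) := by
    filter_upwards [hc.eventually_nhds, htd, hfd, hinv'] with y hy hty hfy hiy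
    have h1 : HasFDerivAt (fun y => f (g y))
        (fderiv ℝ f (g y) ∘L (ContinuousLinearMap.id ℝ E).prod (fderiv ℝ t y)) y :=
      hfy.hasFDerivAt.comp y ((hasFDerivAt_id y).prodMk hty.hasFDerivAt)
    have h2 : HasFDerivAt (fun y => f (g y)) (0 : E →L[ℝ] G) y :=
      (hasFDerivAt_const c y).congr_of_eventuallyEq hy
    have h3 := h1.unique h2
    obtain ⟨M, hM⟩ := hiy
    ext v
    have h4 : fderiv ℝ f (g y) (v, fderiv ℝ t y v) = 0 := by
      simpa using DFunLike.congr_fun h3 v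
    have h5 : (v, fderiv ℝ t y v) = ((v, 0) : E × F) + (0, fderiv ℝ t y v) := by simp
    have h6 : M (fderiv ℝ t y v) = fderiv ℝ f (g y) (0, fderiv ℝ t y v) := by
      simpa using DFunLike.congr_fun hM (fderiv ℝ t y v)
    rw [h5, map_add, ← h6] at h4
    simp only [Ψ, ← hM]
    simp only [ContinuousLinearMap.inverse_equiv, neg_apply,
      ContinuousLinearMap.comp_apply, ContinuousLinearMap.inl_apply]
    rw [← M.symm_apply_apply (fderiv ℝ t y v), ← map_neg]
    exact congrArg M.symm (eq_neg_of_add_eq_zero_right h4)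
  have boot : ∀ j, HolderAt j α t a → HolderAt j α (fderiv ℝ f) (g a) →
      HolderAt (j + 1) α t a := by
    intro j hj hfj
    have hgj : HolderAt j α g a :=
      (holderAt_of_contDiffAt hα contDiffAt_id).prodMk hj
    exact holderAt_succ_iff.2 ⟨htd,
      (HolderAt.smooth_comp (g := fun y => fderiv ℝ f (g y)) hα hΨ
        (HolderAt.comp (g := g) hα0 hα hfj hgj hg1)).congr hD⟩
  -- `boot` needs `Df` in every lower class as well
  have hfk : ∀ j ≤ k, HolderAt j α (fderiv ℝ f) (g a) := by
    intro j hj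
    induction hj using Nat.decreasingInduction with
    | self => exact (holderAt_succ_iff.1 hf).2
    | of_succ j _ ih => exact ih.of_succ hα
  have : ∀ j ≤ k, HolderAt (j + 1) α t a := by
    intro j
    induction j with
    | zero => exact fun h => boot 0 (holderAt_of_contDiffAt hα (by simpa using ht)) (hfk 0 h)
    | succ j ih => exact fun h => boot _ (ih (by omega)) (hfk _ h)
  exact this k le_rfl

end HolderComposition

/-! ### Slopes of line fields -/

section LineFields

/-- The slope `m` of a complex line of `ℂ²` spanned by a vector `(1, m)`; it has no meaning for the
vertical line. -/
noncomputable def lineSlope (l : Set C2) : ℂ :=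
  Classical.epsilon fun m => ((1 : ℂ), m) ∈ l

theorem mem_span_iff_of_fst_ne_zero {X : C2} (hX : X.1 ≠ 0) {m : ℂ} :
    ((1 : ℂ), m) ∈ (Submodule.span ℂ {X} : Set C2) ↔ m = X.2 / X.1 := by
  rw [SetLike.mem_coe, Submodule.mem_span_singleton]
  constructor
  · rintro ⟨a, ha⟩
    have h1 : a * X.1 = 1 := congrArg Prod.fst ha
    have h2 : a * X.2 = m := congrArg Prod.snd ha
    rw [eq_div_iff hX, ← h2]
    linear_combination X.2 * h1
  · rintro rfl
    refine ⟨X.1⁻¹, Prod.ext ?_ ?_⟩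
    · exact inv_mul_cancel₀ hX
    · simp [div_eq_inv_mul]

theorem lineSlope_span {X : C2} (hX : X.1 ≠ 0) :
    lineSlope (Submodule.span ℂ {X} : Set C2) = X.2 / X.1 :=
  (mem_span_iff_of_fst_ne_zero hX).1
    (Classical.epsilon_spec (p := fun m => ((1 : ℂ), m) ∈ (Submodule.span ℂ {X} : Set C2))
      ⟨_, (mem_span_iff_of_fst_ne_zero hX).2 rfl⟩)

theorem fst_ne_zero_of_mem_span {X : C2} {m : ℂ}
    (h : ((1 : ℂ), m) ∈ (Submodule.span ℂ {X} : Set C2)) : X.1 ≠ 0 := by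
  obtain ⟨a, ha⟩ := Submodule.mem_span_singleton.1 h
  intro h0
  have h1 : a * X.1 = 1 := congrArg Prod.fst ha
  simp [h0] at h1

theorem span_eq_span_lineSlope {X : C2} (hX : X.1 ≠ 0) :
    Submodule.span ℂ {((1 : ℂ), lineSlope (Submodule.span ℂ {X} : Set C2))} =
      Submodule.span ℂ {X} := by
  have : X = X.1 • ((1 : ℂ), lineSlope (Submodule.span ℂ {X} : Set C2)) := by
    rw [lineSlope_span hX]
    refine Prod.ext ?_ ?_
    · simp
    · simp [mul_div_cancel₀ _ hX]
  conv_rhs => rw [this]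
  exact (Submodule.span_singleton_smul_eq (IsUnit.mk0 _ hX) _).symm

theorem LineFieldOn.eq_span {E : Type*} [NormedAddCommGroup E] [NormedSpace ℝ E] {s : ℝ}
    {l : E → Set C2} {O : Set E} (h : LineFieldOn s l O) {a : E} (ha : a ∈ O) {m : ℂ}
    (hm : ((1 : ℂ), m) ∈ l a) :
    lineSlope (l a) = m ∧ l a = (Submodule.span ℂ {((1 : ℂ), m)} : Set C2) := by
  obtain ⟨N, X, -, haN, -, -, hX⟩ := h a ha
  have hla := (hX a haN).2
  rw [hla] at hm ⊢
  have h1 := fst_ne_zero_of_mem_span hm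
  have h2 : lineSlope (Submodule.span ℂ {X a} : Set C2) = m := by
    rw [lineSlope_span h1, (mem_span_iff_of_fst_ne_zero h1).1 hm]
  refine ⟨h2, ?_⟩
  rw [← h2, span_eq_span_lineSlope h1]

/-- Near a point where it is not vertical, a line field of class `C^s` is described by a slope of
class `C^s`. -/
theorem LineFieldOn.holderAt_lineSlope {E : Type} [NormedAddCommGroup E] [NormedSpace ℝ E] {s : ℝ}
    {l : E → Set C2} {O : Set E} (h : LineFieldOn s l O) {a : E} (ha : a ∈ O) {m : ℂ}
    (hm : ((1 : ℂ), m) ∈ l a) :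
    HolderAt ⌊s⌋₊ (s - ⌊s⌋₊) (fun b => lineSlope (l b)) a ∧
      ∀ᶠ b in 𝓝 a, l b = (Submodule.span ℂ {((1 : ℂ), lineSlope (l b))} : Set C2) := by
  obtain ⟨N, X, hN, haN, -, hXs, hX⟩ := h a ha
  have hXa : HolderAt ⌊s⌋₊ (s - ⌊s⌋₊) X a := (classOn_iff_holderAt hN).1 hXs a haN
  have h1 : (X a).1 ≠ 0 := by
    rw [(hX a haN).2] at hm
    exact fst_ne_zero_of_mem_span hm
  have h2 : ∀ᶠ b in 𝓝 a, (X b).1 ≠ 0 :=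
    (continuous_fst.continuousAt.comp hXa.1.continuousAt).eventually_ne h1
  constructor
  · have hdiv : ContDiffAt ℝ (⊤ : ℕ∞) (fun p : C2 => p.2 * p.1⁻¹) (X a) :=
      contDiffAt_snd.mul (contDiffAt_fst.inv h1)
    refine (HolderAt.smooth_comp (by linarith [Nat.lt_floor_add_one s]) hdiv hXa).congr ?_
    filter_upwards [h2, hN.mem_nhds haN] with b hb hbN
    rw [(hX b hbN).2, lineSlope_span hb, div_eq_mul_inv]
  · filter_upwards [h2, hN.mem_nhds haN] with b hb hbN
    conv_lhs => rw [(hX b hbN).2]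
    rw [(hX b hbN).2, span_eq_span_lineSlope hb]

end LineFields

/-! ### Slopes along the graphs of a foliation -/

section GraphCharts

variable {r ε ρ δ : ℝ} {leaf : ℂ → C2 → Set C2} {V : Set C2} {q : C2} {W : ℂ → Set C2}
  {g : ℂ → ℂ → ℂ → ℂ}

theorem IsGraphChart.differentiableOn (hg : IsGraphChart r ε ρ δ leaf V q W g) {μ w : ℂ}
    (hμ : μ ∈ Metric.ball (0 : ℂ) ρ) (hw : w ∈ unitDisk) :
    DifferentiableOn ℂ (fun z => g μ z w) unitDisk :=
  (hg.chart.holomorphic μ hμ w hw).snd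

/-- The leaf through a point of the graph of `g μ · w` is tangent to that graph. -/
theorem IsGraphChart.mem_leafTangent (hg : IsGraphChart r ε ρ δ leaf V q W g) {μ w z : ℂ}
    (hμ : μ ∈ Metric.ball (0 : ℂ) ρ) (hw : w ∈ unitDisk) (hz : z ∈ unitDisk) :
    ((1 : ℂ), deriv (fun z => g μ z w) z) ∈ leafTangent leaf (μ, (q.1 + z, g μ z w)) := by
  have hnhds : unitDisk ∈ 𝓝 z := Metric.isOpen_ball.mem_nhds hz
  have h1 : HasDerivAt (fun z => ((q.1 + z, g μ z w) : C2))
      ((1 : ℂ), deriv (fun z => g μ z w) z) z :=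
    ((hasDerivAt_id z).const_add q.1).prodMk
      ((hg.differentiableOn hμ hw).differentiableAt hnhds).hasDerivAt
  have h2 := h1.hasFDerivAt.hasFDerivWithinAt (s := unitDisk) |>.mapsTo_tangent_cone
    (show (1 : ℂ) ∈ tangentConeAt ℂ unitDisk z by
      rw [tangentConeAt_of_mem_nhds hnhds]; trivial)
  have h3 : (fun z => ((q.1 + z, g μ z w) : C2)) '' unitDisk ⊆ leaf μ (q.1 + z, g μ z w) := by
    rintro _ ⟨z', hz', rfl⟩
    exact hg.chart.plaque μ hμ w hw z hz z' hz'
  have h4 := tangentConeAt_mono h3 h2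
  rwa [ContinuousLinearMap.toSpanSingleton_apply, one_smul] at h4

/-- If `S` restricts to `g'` along the graph of `g`, then the derivative of `S` in the direction of
the complex tangent line of the graph is multiplication by `g''`. -/
theorem fderiv_apply_tangent {g : ℂ → ℂ} (hg : DifferentiableOn ℂ g unitDisk) {S : ℂ × C2 → ℂ}
    {q : C2} (hgq : g 0 = q.2) (hS : DifferentiableAt ℝ S (0, q))
    (hSg : ∀ᶠ z in 𝓝 (0 : ℂ), S (0, (q.1 + z, g z)) = deriv g z) (ζ : ℂ) :
    fderiv ℝ S (0, q) (0, (ζ, deriv g 0 * ζ)) = iteratedDeriv 2 g 0 * ζ := by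
  have h0 : (0 : ℂ) ∈ unitDisk := Metric.mem_ball_self one_pos
  have hnhds : unitDisk ∈ 𝓝 (0 : ℂ) := Metric.isOpen_ball.mem_nhds h0
  have h1 : HasFDerivAt (𝕜 := ℝ) g _ 0 :=
    (hg.differentiableAt hnhds).hasDerivAt.hasFDerivAt.restrictScalars ℝ
  have h2 : HasFDerivAt (𝕜 := ℝ) (deriv g) _ 0 :=
    ((hg.deriv Metric.isOpen_ball).differentiableAt hnhds).hasDerivAt.hasFDerivAt.restrictScalars ℝ
  have h3 : HasFDerivAt (𝕜 := ℝ) (fun z : ℂ => (((0 : ℂ), (q.1 + z, g z)) : ℂ × C2)) _ 0 :=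
    (hasFDerivAt_const (0 : ℂ) (0 : ℂ)).prodMk
      (((hasFDerivAt_id (𝕜 := ℝ) (0 : ℂ)).const_add q.1).prodMk h1)
  have hq : (((0 : ℂ), (q.1 + 0, g 0)) : ℂ × C2) = (0, q) := by simp [hgq]
  have h4 : HasFDerivAt S (fderiv ℝ S (0, q)) (((0 : ℂ), (q.1 + 0, g 0)) : ℂ × C2) := by
    rw [hq]; exact hS.hasFDerivAt
  have h5 := (h4.comp (0 : ℂ) h3).unique (h2.congr_of_eventuallyEq hSg)
  have h6 := DFunLike.congr_fun h5 ζ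
  simp only [iteratedDeriv_succ, iteratedDeriv_zero]
  simpa [mul_comm] using h6

end GraphCharts

/-! ### The zero set of a function with complex-linear derivative along a line -/

section ImplicitTangency

/-- The coordinates `(t, y)` centred at `q` in which the lines `y = const` have slope `m`. -/
def shear (q : C2) (m y t : ℂ) : C2 := (q.1 + t, q.2 + m * t + y)

/-- The map `ζ ↦ (0, (ζ, m ζ))`, whose image is the complex line of slope `m` in `ℂ²` inside the
space `ℂ × ℂ²` of pairs (parameter, point). It is taken over `ℝ`, as slopes are only real
differentiable. -/
noncomputable def slopeDirection (m : ℂ) : ℂ →L[ℝ] ℂ × C2 :=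
  (0 : ℂ →L[ℝ] ℂ).prod ((ContinuousLinearMap.id ℝ ℂ).prod
    ((ContinuousLinearMap.mul ℝ ℂ) m))

@[simp]
theorem slopeDirection_apply (m ζ : ℂ) : slopeDirection m ζ = (0, (ζ, m * ζ)) := rfl

theorem isInvertible_of_forall_mul {A : ℂ →L[ℝ] ℂ} {c : ℂ} (hc : c ≠ 0) (hA : ∀ ζ, A ζ = c * ζ) :
    A.IsInvertible := by
  refine ⟨(ContinuousLinearEquiv.unitsEquivAut ℂ (Units.mk0 c hc)).restrictScalars ℝ, ?_⟩
  exact ContinuousLinearMap.ext fun ζ => (mul_comm ζ c).trans (hA ζ).symm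

theorem contDiff_shear (q : C2) (m : ℂ) {n : WithTop ℕ∞} :
    ContDiff ℝ n fun p : ℂ × ℂ => shear q m p.1 p.2 := by
  unfold shear
  fun_prop

variable {q : C2} {m : ℂ} {D : ℂ × C2 → ℂ} {α : ℝ} {k : ℕ} {t : ℂ × ℂ → ℂ}

theorem hasFDerivAt_shear_right (y t : ℂ) (μ : ℂ) :
    HasFDerivAt (𝕜 := ℝ) (fun t => ((μ, shear q m y t) : ℂ × C2)) (slopeDirection m) t := by
  have h : HasFDerivAt (𝕜 := ℝ) (fun t => q.2 + m * t + y) ((ContinuousLinearMap.mul ℝ ℂ) m) t :=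
    (((ContinuousLinearMap.mul ℝ ℂ) m).hasFDerivAt.const_add q.2).add_const y
  exact (hasFDerivAt_const μ t).prodMk (((hasFDerivAt_id (𝕜 := ℝ) t).const_add q.1).prodMk h)

/-- The partial derivative in `t` of a function written in the coordinates `shear`, possibly with
further variables `a` on which the parameter and `y` depend. -/
theorem fderiv_comp_shear_inr {E : Type*} [NormedAddCommGroup E] [NormedSpace ℝ E]
    {M Y : E → ℂ} (hM : ContDiff ℝ 1 M) (hY : ContDiff ℝ 1 Y) {a : E} {t : ℂ}
    (hD : DifferentiableAt ℝ D (M a, shear q m (Y a) t)) :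
    fderiv ℝ (fun p : E × ℂ => D (M p.1, shear q m (Y p.1) p.2)) (a, t) ∘L .inr ℝ E ℂ =
      fderiv ℝ D (M a, shear q m (Y a) t) ∘L slopeDirection m := by
  have h1 : DifferentiableAt ℝ (fun p : E × ℂ => ((M p.1, shear q m (Y p.1) p.2) : ℂ × C2))
      (a, t) :=
    (((hM.comp contDiff_fst).prodMk ((contDiff_shear q m).comp
      ((hY.comp contDiff_fst).prodMk contDiff_snd))).differentiable (by simp)).differentiableAt
  have h2 : DifferentiableAt ℝ (fun p : E × ℂ => D (M p.1, shear q m (Y p.1) p.2)) (a, t) :=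
    DifferentiableAt.comp (g := D) (a, t) hD h1
  have h3 : HasFDerivAt (𝕜 := ℝ) (fun t : ℂ => (a, t)) (ContinuousLinearMap.inr ℝ E ℂ) t :=
    hasFDerivAt_prodMk_right a t
  have h4 := HasFDerivAt.comp t h2.hasFDerivAt h3
  exact h4.unique (hD.hasFDerivAt.comp t (hasFDerivAt_shear_right (Y a) t (M a)))

/-- If the derivative of `D` along the complex direction of slope `m` is a nonzero complex number,
the zero set of `D` is, near `(0, q)`, a graph `t = t(μ, y)` in the coordinates `shear`. -/
theorem exists_implicit_shear (hD : ContDiffAt ℝ 1 D (0, q)) (h0 : D (0, q) = 0) {c : ℂ}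
    (hc : c ≠ 0) (hDc : ∀ ζ, fderiv ℝ D (0, q) (0, (ζ, m * ζ)) = c * ζ) :
    ∃ t : ℂ × ℂ → ℂ, t 0 = 0 ∧ ContDiffAt ℝ 1 t 0 ∧
      ∀ᶠ a in 𝓝 (0 : ℂ × ℂ), D (a.1, shear q m a.2 (t a)) = 0 ∧
        (fderiv ℝ D (a.1, shear q m a.2 (t a)) ∘L slopeDirection m).IsInvertible := by
  have hbase : (((0 : ℂ × ℂ).1, shear q m (0 : ℂ × ℂ).2 0) : ℂ × C2) = (0, q) := by
    simp [shear]
  let P : (ℂ × ℂ) × ℂ → ℂ × C2 := fun p => (p.1.1, shear q m p.1.2 p.2)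
  have hP : ContDiff ℝ 1 P :=
    contDiff_fst.fst.prodMk ((contDiff_shear q m).comp (contDiff_fst.snd.prodMk contDiff_snd))
  have hP0 : P ((0 : ℂ × ℂ), 0) = (0, q) := hbase
  have hf : ContDiffAt ℝ 1 (fun p => D (P p)) ((0 : ℂ × ℂ), 0) :=
    ContDiffAt.comp (g := D) _ (by rwa [hP0]) hP.contDiffAt
  have hinv : (fderiv ℝ D (0, q) ∘L slopeDirection m).IsInvertible :=
    isInvertible_of_forall_mul hc fun ζ => by simpa using hDc ζ
  have hinv' : (fderiv ℝ (fun p => D (P p)) ((0 : ℂ × ℂ), 0) ∘L .inr ℝ (ℂ × ℂ) ℂ).IsInvertible := by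
    have := fderiv_comp_shear_inr (D := D) (q := q) (m := m) (M := Prod.fst) (Y := Prod.snd)
      (a := (0 : ℂ × ℂ)) (t := 0) contDiff_fst contDiff_snd
      (by rw [hbase]; exact hD.differentiableAt (by simp))
    rw [hbase] at this
    rw [this]
    exact hinv
  have ht0 := hf.implicitFunction_apply_self one_ne_zero hinv'
  have ht1 := hf.contDiffAt_implicitFunction one_ne_zero hinv'
  refine ⟨hf.implicitFunction one_ne_zero hinv', ht0, ht1, ?_⟩
  refine Filter.Eventually.and ?_ ?_
  · filter_upwards [hf.eventually_apply_implicitFunction one_ne_zero hinv'] with a ha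
    exact ha.trans (by rw [hP0, h0])
  · generalize hf.implicitFunction one_ne_zero hinv' = t at ht0 ht1
    change t 0 = 0 at ht0
    have hcont : ContinuousAt (fun a : ℂ × ℂ => P (a, t a)) 0 :=
      hP.continuous.continuousAt.comp (continuousAt_id.prodMk ht1.continuousAt)
    have hDf : ContinuousAt (fderiv ℝ D) (P (0, t 0)) := by
      rw [ht0, hP0]
      exact (hD.fderiv_right (m := 0) (by simp)).continuousAt
    have h2 : ContinuousAt (fun a : ℂ × ℂ => fderiv ℝ D (P (a, t a)) ∘L slopeDirection m) 0 :=
      (ContinuousAt.comp (f := fun a : ℂ × ℂ => P (a, t a)) hDf hcont).clm_comp continuousAt_const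
    have h3 : {A : ℂ →L[ℝ] ℂ | A.IsInvertible} ∈
        𝓝 (fderiv ℝ D (P (0, t 0)) ∘L slopeDirection m) := by
      rw [ht0, hP0]
      obtain ⟨M, hM⟩ := hinv
      have := M.nhds
      rwa [hM] at this
    exact h2 h3

/-- The regularity of the implicit function of `exists_implicit_shear` in all variables. -/
theorem holderAt_implicit_shear (hα0 : 0 ≤ α) (hα : α ≤ 1) (hk : 1 ≤ k) {a : ℂ × ℂ}
    (hD : HolderAt k α D (a.1, shear q m a.2 (t a))) (ht : ContDiffAt ℝ 1 t a)
    (h0 : ∀ᶠ a in 𝓝 a, D (a.1, shear q m a.2 (t a)) = 0)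
    (hinv : (fderiv ℝ D (a.1, shear q m a.2 (t a)) ∘L slopeDirection m).IsInvertible) :
    HolderAt k α t a := by
  obtain ⟨j, rfl⟩ : ∃ j, k = j + 1 := ⟨k - 1, by omega⟩
  have hP : ∀ n, ContDiff ℝ n fun p : (ℂ × ℂ) × ℂ => ((p.1.1, shear q m p.1.2 p.2) : ℂ × C2) :=
    fun n => contDiff_fst.fst.prodMk
      ((contDiff_shear q m).comp (contDiff_fst.snd.prodMk contDiff_snd))
  refine HolderAt.implicit (f := fun p => D (p.1.1, shear q m p.1.2 p.2)) (c := 0) hα0 hα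
    (HolderAt.comp hα0 hα (f := D) hD (holderAt_of_contDiffAt hα (hP _).contDiffAt)
      (hP 1).contDiffAt) ht ?_ h0
  rw [fderiv_comp_shear_inr (D := D) (M := Prod.fst) (Y := Prod.snd) contDiff_fst contDiff_snd
    (hD.1.differentiableAt (by simp))]
  exact hinv

/-- The regularity of the implicit function of `exists_implicit_shear` for a fixed parameter, where
only the regularity of `D` for that parameter matters. -/
theorem holderAt_implicit_shear_fiber (hα0 : 0 ≤ α) (hα : α ≤ 1) (hk : 1 ≤ k) {μ y : ℂ}
    (hD1 : DifferentiableAt ℝ D (μ, shear q m y (t (μ, y))))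
    (hD : HolderAt k α (fun x => D (μ, x)) (shear q m y (t (μ, y)))) (ht : ContDiffAt ℝ 1 t (μ, y))
    (h0 : ∀ᶠ a in 𝓝 (μ, y), D (a.1, shear q m a.2 (t a)) = 0)
    (hinv : (fderiv ℝ D (μ, shear q m y (t (μ, y))) ∘L slopeDirection m).IsInvertible) :
    HolderAt k α (fun y => t (μ, y)) y := by
  obtain ⟨j, rfl⟩ : ∃ j, k = j + 1 := ⟨k - 1, by omega⟩
  have hi : ContDiffAt ℝ 1 (fun y : ℂ => (μ, y)) y := contDiffAt_const.prodMk contDiffAt_id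
  refine HolderAt.implicit (f := fun p : ℂ × ℂ => D (μ, shear q m p.1 p.2)) (c := 0) hα0 hα
    (HolderAt.comp hα0 hα (f := fun x => D (μ, x)) hD
      (holderAt_of_contDiffAt hα (contDiff_shear q m).contDiffAt)
      (contDiff_shear q m).contDiffAt)
    (ContDiffAt.comp y ht hi) ?_ (hi.continuousAt.eventually h0)
  rw [fderiv_comp_shear_inr (D := D) (M := fun _ => μ) (Y := fun y => y) contDiff_const contDiff_id
    hD1]
  exact hinv

end ImplicitTangency

/-! ### Disks that are graphs in sheared coordinates -/

section TangencyDisks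

variable {s : ℝ} {q : C2} {m : ℂ} {κ : ℝ}

theorem one_le_floor_of_one_le (hs : 1 ≤ s) : 1 ≤ ⌊s⌋₊ := Nat.le_floor (by exact_mod_cast hs)

theorem sub_floor_nonneg (hs : 1 ≤ s) : 0 ≤ s - ⌊s⌋₊ :=
  sub_nonneg.2 (Nat.floor_le (by linarith))

theorem sub_floor_le_one : s - ⌊s⌋₊ ≤ 1 := by linarith [Nat.lt_floor_add_one s]

theorem mul_mem_ball {κ : ℝ} (hκ : 0 < κ) {ζ : ℂ} (hζ : ζ ∈ unitDisk) :
    (κ : ℂ) * ζ ∈ Metric.ball (0 : ℂ) κ := by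
  rw [mem_ball_zero_iff] at hζ ⊢
  rw [norm_mul, Complex.norm_real, Real.norm_of_nonneg hκ.le]
  exact mul_lt_of_lt_one_right hκ hζ

/-- A graph over the `y`-coordinate of `shear` is embedded with the regularity of the function
defining it, since `y` is an affine function of the point. -/
theorem embedsDisk_shear (hs : 1 ≤ s) (hκ : 0 < κ) {τ : ℂ → ℂ}
    (hτ : ∀ y ∈ Metric.ball (0 : ℂ) κ, HolderAt ⌊s⌋₊ (s - ⌊s⌋₊) τ y) :
    EmbedsDisk s fun ζ => shear q m (κ * ζ) (τ (κ * ζ)) := by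
  have hα0 := sub_floor_nonneg hs
  have hα := sub_floor_le_one (s := s)
  have hlin : ∀ n, ContDiff ℝ n fun ζ : ℂ => (κ : ℂ) * ζ := fun n => contDiff_const.mul contDiff_id
  have hH : ∀ ζ ∈ unitDisk,
      HolderAt ⌊s⌋₊ (s - ⌊s⌋₊) (fun ζ => shear q m (κ * ζ) (τ (κ * ζ))) ζ := by
    intro ζ hζ
    have h1 : HolderAt ⌊s⌋₊ (s - ⌊s⌋₊) (fun ζ : ℂ => (κ : ℂ) * ζ) ζ :=
      holderAt_of_contDiffAt hα (hlin _).contDiffAt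
    exact HolderAt.smooth_comp hα (f := fun p : ℂ × ℂ => shear q m p.1 p.2)
      (contDiff_shear q m).contDiffAt
      (h1.prodMk (HolderAt.comp hα0 hα (hτ _ (mul_mem_ball hκ hζ)) h1 (hlin 1).contDiffAt))
  have hdiff : ∀ ζ ∈ unitDisk,
      DifferentiableAt ℝ (fun ζ => shear q m (κ * ζ) (τ (κ * ζ))) ζ := fun ζ hζ =>
    (hH ζ hζ).1.differentiableAt (by
      have := one_le_floor_of_one_le hs
      simp only [ne_eq, Nat.cast_eq_zero]
      omega)
  let p : C2 → ℂ := fun x => (κ : ℂ)⁻¹ * (x.2 - q.2 - m * (x.1 - q.1))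
  have hp : Differentiable ℝ p := by fun_prop
  have hpb : ∀ ζ, p (shear q m (κ * ζ) (τ (κ * ζ))) = ζ := by
    intro ζ
    have hκ' : (κ : ℂ) ≠ 0 := Complex.ofReal_ne_zero.2 hκ.ne'
    simp only [p, shear]
    field_simp
    ring
  refine ⟨(classOn_iff_holderAt Metric.isOpen_ball).2 hH, fun ζ hζ => ?_, ?_⟩
  · have h1 := (hp _).hasFDerivAt.comp ζ (hdiff ζ hζ).hasFDerivAt
    have h2 : p ∘ (fun ζ => shear q m (κ * ζ) (τ (κ * ζ))) = id := funext hpb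
    rw [h2] at h1
    have h3 := h1.unique (hasFDerivAt_id ζ)
    exact Function.LeftInverse.injective (g := fderiv ℝ p (shear q m (κ * ζ) (τ (κ * ζ))))
      fun v => DFunLike.congr_fun h3 v
  · refine IsEmbedding.of_comp (g := p) ?_ hp.continuous ?_
    · exact continuousOn_iff_continuous_domRestrict.1
        fun ζ hζ => (hdiff ζ hζ).continuousAt.continuousWithinAt
    · have h2 : p ∘ unitDisk.domRestrict (fun ζ => shear q m (κ * ζ) (τ (κ * ζ))) =
          Subtype.val := funext fun ζ => hpb ζ
      rw [h2]
      exact IsEmbedding.subtypeVal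

/-- The family version of the regularity of `embedsDisk_shear`, with the parameter as a variable. -/
theorem classOn_shear (hs : 1 ≤ s) (hκ : 0 < κ) {M : Set ℂ} (hM : IsOpen M) {t : ℂ × ℂ → ℂ}
    (ht : ∀ a ∈ M ×ˢ Metric.ball (0 : ℂ) κ, HolderAt ⌊s⌋₊ (s - ⌊s⌋₊) t a) :
    ClassOn s (fun a : ℂ × ℂ => shear q m (κ * a.2) (t (a.1, κ * a.2))) (M ×ˢ unitDisk) := by
  have hα0 := sub_floor_nonneg hs
  have hα := sub_floor_le_one (s := s)
  refine (classOn_iff_holderAt (hM.prod Metric.isOpen_ball)).2 fun a ha => ?_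
  have hlin : ∀ n, ContDiff ℝ n fun a : ℂ × ℂ => (a.1, (κ : ℂ) * a.2) := fun n =>
    contDiff_fst.prodMk (contDiff_const.mul contDiff_snd)
  have h1 : HolderAt ⌊s⌋₊ (s - ⌊s⌋₊) (fun a : ℂ × ℂ => (a.1, (κ : ℂ) * a.2)) a :=
    holderAt_of_contDiffAt hα (hlin _).contDiffAt
  have h2 := HolderAt.comp (g := fun a : ℂ × ℂ => (a.1, (κ : ℂ) * a.2)) hα0 hα
    (ht (a.1, κ * a.2) ⟨ha.1, mul_mem_ball hκ ha.2⟩) h1 (hlin 1).contDiffAt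
  exact HolderAt.smooth_comp hα (f := fun p : ℂ × ℂ => shear q m p.1 p.2)
    (contDiff_shear q m).contDiffAt ((h1.clm_comp (ContinuousLinearMap.snd ℝ ℂ ℂ)).prodMk h2)

end TangencyDisks

/-! ### Slopes of the foliations near the tangency -/

section FoliationSlopes

variable {r ε ρ δ : ℝ} {H : ℂ → Equiv.Perm C2} {U L : Set C2} {O : Set (ℂ × C2)}
  {leaf : ℂ → C2 → Set C2} {V : Set C2} {q : C2} {W : ℂ → Set C2} {g : ℂ → ℂ → ℂ → ℂ}

theorem IsGraphChart.one_slope_mem (hg : IsGraphChart r ε ρ δ leaf V q W g) (hρ : 0 < ρ) :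
    ((1 : ℂ), deriv (fun z => g 0 z 0) 0) ∈ leafTangent leaf (0, q) := by
  have := hg.mem_leafTangent (Metric.mem_ball_self hρ) (w := 0) (z := 0)
    (Metric.mem_ball_self one_pos) (Metric.mem_ball_self one_pos)
  rw [hg.base] at this
  simpa using this

/-- The slope of a foliation with a graph chart restricts to the derivative of `g₀(·, 0)` along the
corresponding leaf. Hence its derivative along the tangent line of that leaf at `q` is given by the
second derivative of `g₀(·, 0)`. -/
theorem IsGraphChart.fderiv_lineSlope (hg : IsGraphChart r ε ρ δ leaf V q W g) (hρ : 0 < ρ)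
    {s : ℝ} (hl : LineFieldOn s (leafTangent leaf) O) (hO : ∀ x ∈ V, ((0, x) : ℂ × C2) ∈ O)
    (hd : DifferentiableAt ℝ (fun b => lineSlope (leafTangent leaf b)) (0, q)) (ζ : ℂ) :
    fderiv ℝ (fun b => lineSlope (leafTangent leaf b)) (0, q)
      (0, (ζ, deriv (fun z => g 0 z 0) 0 * ζ)) = iteratedDeriv 2 (fun z => g 0 z 0) 0 * ζ := by
  have h0 : (0 : ℂ) ∈ unitDisk := Metric.mem_ball_self one_pos
  have h0ρ : (0 : ℂ) ∈ Metric.ball (0 : ℂ) ρ := Metric.mem_ball_self hρ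
  refine fderiv_apply_tangent (hg.differentiableOn h0ρ h0) hg.base hd ?_ ζ
  filter_upwards [Metric.isOpen_ball.mem_nhds h0] with z hz
  exact (hl.eq_span (hO _ (hg.chart.mapsTo 0 h0ρ z hz 0 h0)) (hg.mem_leafTangent h0ρ h0 hz)).1

/-- For each parameter the slope is `C^{1+ε}` at every point where the leaf is not vertical,
whatever the joint regularity is. -/
theorem IsUnstableFoliation.holderAt_lineSlope_fiber (hu : IsUnstableFoliation r ε ρ H U L O leaf)
    {μ : ℂ} {x : C2} (hb : (μ, x) ∈ O)
    (hl : leafTangent leaf (μ, x) =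
      (Submodule.span ℂ {((1 : ℂ), lineSlope (leafTangent leaf (μ, x)))} : Set C2)) :
    HolderAt ⌊1 + ε⌋₊ (1 + ε - ⌊1 + ε⌋₊) (fun x => lineSlope (leafTangent leaf (μ, x))) x := by
  refine ((hu.tangent_fiber μ (hu.param _ hb)).holderAt_lineSlope (a := x) hb
    (m := lineSlope (leafTangent leaf (μ, x))) ?_).1
  have h := Submodule.mem_span_singleton_self (R := ℂ)
    ((1 : ℂ), lineSlope (leafTangent leaf (μ, x)))
  rw [← SetLike.mem_coe, ← hl] at h
  exact h

end FoliationSlopes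

/-! ### The disks of tangencies -/

theorem mainTheorem3
    (r ε ρ δ : ℝ) (hr : 1 ≤ r) (hε : 0 < ε) (hε1 : ε < 1) (hρ : 0 < ρ) (hρ1 : ρ ≤ 1) (hδ : 0 < δ)
    -- the family, its horseshoe, the continuation of the saddle, and the homoclinic tangency
    (H : ℂ → Equiv.Perm C2) (hH : IsAutFamily r H)
    (U : Set C2) (hU : IsOpen U) (hΛ : IsHorseshoe (H 0) (maxInvariant (H 0) U))
    (p : ℂ → C2) (hp : ClassOn r p (Metric.ball 0 ρ))
    (hpfix : ∀ μ ∈ Metric.ball (0 : ℂ) ρ,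
      IsFixedSaddle (H μ) (p μ) ∧ p μ ∈ maxInvariant (H μ) U)
    (q : C2) (hq : IsHomoclinicTangency (H 0) (p 0) q)
    -- the unstable and stable foliations, extended to the neighbourhood `V` of `q`
    (L : Set C2) (hL : IsCompact L)
    (Ou Os : Set (ℂ × C2)) (leafu leafs : ℂ → C2 → Set C2)
    (hu : IsUnstableFoliation r ε ρ H U L Ou leafu)
    (hs : IsUnstableFoliation r ε ρ (fun μ => (H μ)⁻¹) U L Os leafs)
    (V : Set C2) (hV : IsOpen V) (hqV : q ∈ V)
    (hVu : ExtendedByIteration ρ H L Ou leafu V q)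
    (hVs : ExtendedByIteration ρ (fun μ => (H μ)⁻¹) L Os leafs V q)
    -- their description by graphs near `q`
    (gu gs : ℂ → ℂ → ℂ → ℂ)
    (hgu : IsGraphChart r ε ρ δ leafu V q (fun μ => unstableSet (H μ) (p μ)) gu)
    (hgs : IsGraphChart r ε ρ δ leafs V q (fun μ => stableSet (H μ) (p μ)) gs)
    -- the tangency at `q` is quadratic
    (htan : deriv (fun z => gu 0 z 0) 0 = deriv (fun z => gs 0 z 0) 0)
    (hquad : iteratedDeriv 2 (fun z => gu 0 z 0) 0 ≠ iteratedDeriv 2 (fun z => gs 0 z 0) 0) :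
    ∃ (ρ' : ℝ) (b : ℂ → ℂ → C2), 0 < ρ' ∧ ρ' ≤ ρ ∧ b 0 0 = q ∧
      (∀ μ ∈ Metric.ball (0 : ℂ) ρ', EmbedsDisk (1 + ε) (b μ) ∧
        ∀ ζ ∈ unitDisk, b μ ζ ∈ V ∧
          TangentAt (leafu μ (b μ ζ)) (leafs μ (b μ ζ)) (b μ ζ)) ∧
      ClassOn (min r (1 + ε)) (fun a : ℂ × ℂ => b a.1 a.2) (Metric.ball 0 ρ' ×ˢ unitDisk) ∧
      ((∃ N : Set (ℂ × C2), IsOpen N ∧ ((0, q) : ℂ × C2) ∈ N ∧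
          LineFieldOn r (leafTangent leafu) N ∧ LineFieldOn r (leafTangent leafs) N) →
        ClassOn r (fun a : ℂ × ℂ => b a.1 a.2) (Metric.ball 0 ρ' ×ˢ unitDisk)) := by
  have h0ρ : (0 : ℂ) ∈ Metric.ball (0 : ℂ) ρ := Metric.mem_ball_self hρ
  have hOu : ∀ x ∈ V, ((0, x) : ℂ × C2) ∈ Ou := fun x hx => by
    obtain ⟨n, -, h⟩ := hVu
    exact (h 0 h0ρ x hx).1
  have hOs : ∀ x ∈ V, ((0, x) : ℂ × C2) ∈ Os := fun x hx => by
    obtain ⟨n, -, h⟩ := hVs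
    exact (h 0 h0ρ x hx).1
  have hs1 : 1 ≤ min r (1 + ε) := le_min hr (by linarith)
  set s := min r (1 + ε)
  set m := deriv (fun z => gu 0 z 0) 0
  set Su : ℂ × C2 → ℂ := fun b => lineSlope (leafTangent leafu b)
  set Ss : ℂ × C2 → ℂ := fun b => lineSlope (leafTangent leafs b)
  let D : ℂ × C2 → ℂ := fun b => Su b - Ss b
  have hmu : ((1 : ℂ), m) ∈ leafTangent leafu (0, q) := hgu.one_slope_mem hρ
  have hms : ((1 : ℂ), m) ∈ leafTangent leafs (0, q) := htan ▸ hgs.one_slope_mem hρ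
  obtain ⟨hHu, hspanu⟩ := hu.tangent_joint.holderAt_lineSlope (hOu q hqV) hmu
  obtain ⟨hHs, hspans⟩ := hs.tangent_joint.holderAt_lineSlope (hOs q hqV) hms
  have hk1 : (1 : WithTop ℕ∞) ≤ (⌊s⌋₊ : ℕ) := by exact_mod_cast one_le_floor_of_one_le hs1
  have hSu1 : ContDiffAt ℝ 1 Su (0, q) := hHu.1.of_le hk1
  have hSs1 : ContDiffAt ℝ 1 Ss (0, q) := hHs.1.of_le hk1
  have hD1 : ContDiffAt ℝ 1 D (0, q) := hSu1.sub hSs1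
  have hD0 : D (0, q) = 0 := by
    have h1 : Su (0, q) = m := (hu.tangent_joint.eq_span (hOu q hqV) hmu).1
    have h2 : Ss (0, q) = m := (hs.tangent_joint.eq_span (hOs q hqV) hms).1
    simp only [D, h1, h2, sub_self]
  have hDc : ∀ ζ, fderiv ℝ D (0, q) (0, (ζ, m * ζ)) =
      (iteratedDeriv 2 (fun z => gu 0 z 0) 0 - iteratedDeriv 2 (fun z => gs 0 z 0) 0) * ζ := by
    intro ζ
    have hdu := hSu1.differentiableAt one_ne_zero
    have hds := hSs1.differentiableAt one_ne_zero
    have e1 := hgu.fderiv_lineSlope hρ hu.tangent_joint hOu hdu ζ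
    have e2 := hgs.fderiv_lineSlope hρ hs.tangent_joint hOs hds ζ
    rw [← htan] at e2
    have e3 : fderiv ℝ D (0, q) = fderiv ℝ Su (0, q) - fderiv ℝ Ss (0, q) := fderiv_sub hdu hds
    rw [e3, sub_mul, ← e1, ← e2]
    rfl
  obtain ⟨t, ht0, ht1, hsol⟩ := exists_implicit_shear hD1 hD0 (sub_ne_zero.2 hquad) hDc
  -- the point of the tangency locus with coordinates `(μ, y)`, together with its parameter
  let P : ℂ × ℂ → ℂ × C2 := fun a => (a.1, shear q m a.2 (t a))
  have hP0 : P 0 = (0, q) := by simp [P, shear, ht0]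
  have hP : Tendsto P (𝓝 0) (𝓝 (0, q)) := by
    have h1 : ContinuousAt P 0 := continuousAt_fst.prodMk
      ((contDiff_shear q m (n := 0)).continuous.continuousAt.comp
        (continuousAt_snd.prodMk ht1.continuousAt))
    have h2 := h1.tendsto
    rwa [hP0] at h2
  -- `ρ'` may depend on whether the line fields are `C^r` near `(0, q)`: if they are, the disks are
  -- taken inside the region where `D` is `C^r`
  let J : Prop := ∃ N : Set (ℂ × C2), IsOpen N ∧ ((0, q) : ℂ × C2) ∈ N ∧
    LineFieldOn r (leafTangent leafu) N ∧ LineFieldOn r (leafTangent leafs) N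
  have hJ : ∀ᶠ x in 𝓝 ((0, q) : ℂ × C2), J → HolderAt ⌊r⌋₊ (r - ⌊r⌋₊) D x := by
    by_cases hJ : J
    · obtain ⟨N, -, hqN, hNu, hNs⟩ := id hJ
      filter_upwards [((hNu.holderAt_lineSlope hqN hmu).1.sub
        (hNs.holderAt_lineSlope hqN hms).1).eventually] with x hx _ using hx
    · exact Eventually.of_forall fun _ h => absurd h hJ
  have hVnhds : ∀ᶠ x in 𝓝 ((0, q) : ℂ × C2), x.2 ∈ V :=
    continuousAt_snd.eventually (hV.mem_nhds hqV)
  have hgood := hP.eventually <| (hHu.sub hHs).eventually.and <| hJ.and <| hspanu.and <|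
    hspans.and <| (hu.isOpen.eventually_mem (hOu q hqV)).and <|
    (hs.isOpen.eventually_mem (hOs q hqV)).and hVnhds
  have hall := (hgood.and (ht1.eventually (by simp))).and (hsol.and hsol.eventually_nhds)
  obtain ⟨κ, hκ, hball⟩ := Metric.eventually_nhds_iff_ball.1 hall
  have hmem : ∀ μ ∈ Metric.ball (0 : ℂ) (min κ ρ), ∀ y ∈ Metric.ball (0 : ℂ) κ,
      ((μ, y) : ℂ × ℂ) ∈ Metric.ball (0 : ℂ × ℂ) κ := by
    intro μ hμ y hy
    have : ((0 : ℂ), (0 : ℂ)) = (0 : ℂ × ℂ) := rfl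
    rw [← this, ← ball_prod_same]
    exact ⟨Metric.ball_subset_ball (min_le_left _ _) hμ, hy⟩
  have hε' : (1 : ℝ) ≤ 1 + ε := by linarith
  refine ⟨min κ ρ, fun μ ζ => shear q m (κ * ζ) (t (μ, κ * ζ)), lt_min hκ hρ, min_le_right _ _,
    ?_, fun μ hμ => ⟨?_, fun ζ hζ => ?_⟩, ?_, fun hN => ?_⟩
  · have : t ((0 : ℂ), (0 : ℂ)) = 0 := ht0
    simp [shear, this]
  · refine embedsDisk_shear (τ := fun y => t (μ, y)) hε' hκ fun y hy => ?_
    obtain ⟨⟨⟨hD, -, hlu, hls, hPu, hPs, -⟩, hta⟩, hsa, hev⟩ := hball _ (hmem μ hμ y hy)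
    refine holderAt_implicit_shear_fiber (D := D) (sub_floor_nonneg hε') sub_floor_le_one
      (one_le_floor_of_one_le hε') ((hD.1.of_le hk1).differentiableAt one_ne_zero) ?_ hta
      (hev.mono fun _ h => h.1) hsa.2
    exact (hu.holderAt_lineSlope_fiber hPu hlu).sub (hs.holderAt_lineSlope_fiber hPs hls)
  · obtain ⟨⟨⟨-, -, hlu, hls, hPu, hPs, hPV⟩, -⟩, hsa, -⟩ :=
      hball _ (hmem μ hμ _ (mul_mem_ball hκ hζ))
    refine ⟨hPV, hu.mem_leaf _ _ hPu, hs.mem_leaf _ _ hPs, ?_⟩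
    have heq : Su (P (μ, κ * ζ)) = Ss (P (μ, κ * ζ)) := sub_eq_zero.1 hsa.1
    change leafTangent leafu (P (μ, κ * ζ)) = leafTangent leafs (P (μ, κ * ζ))
    rw [hlu, hls]
    change (Submodule.span ℂ {((1 : ℂ), Su (P (μ, κ * ζ)))} : Set C2) =
      (Submodule.span ℂ {((1 : ℂ), Ss (P (μ, κ * ζ)))} : Set C2)
    rw [heq]
  · refine classOn_shear hs1 hκ Metric.isOpen_ball fun a ha => ?_
    obtain ⟨⟨⟨hD, -⟩, hta⟩, hsa, hev⟩ := hball _ (hmem a.1 ha.1 a.2 ha.2)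
    exact holderAt_implicit_shear (sub_floor_nonneg hs1) sub_floor_le_one
      (one_le_floor_of_one_le hs1) hD hta (hev.mono fun _ h => h.1) hsa.2
  · refine classOn_shear hr hκ Metric.isOpen_ball fun a ha => ?_
    obtain ⟨⟨⟨-, hD, -⟩, hta⟩, hsa, hev⟩ := hball _ (hmem a.1 ha.1 a.2 ha.2)
    exact holderAt_implicit_shear (sub_floor_nonneg hr) sub_floor_le_one
      (one_le_floor_of_one_le hr) (hD hN) hta (hev.mono fun _ h => h.1) hsa.2
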